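/- Let $\mathsf{k}$ be a field of characteristic zero, let $X=\{x_1,\dots,x_m\}$ be a finite set, and let ${\rm Ass}_X$ be the free associative $\mathsf{k}$-algebra on $X$ (noncommutative polynomials in the $x_i$), with homogeneous components ${\rm Ass}_X^k$. Let $L_X\subset{\rm Ass}_X$ be the Lie subalgebra generated by $X$ for the bracket $[a,b]=ab-ba$, and $L_X^k=L_X\cap{\rm Ass}_X^k$. Let $*$ be the bilinear shuffle product on ${\rm Ass}_X$: for two words $u,v$ of lengths $r,s$, $u*v$ is the sum of the $\binom{r+s}{r}$ words, counted with multiplicity, obtained by interleaving $u$ and $v$ while keeping the letters of each of them in their original order. Let $$S_X^k={\rm Span}\{\,\omega_1*\omega_2 : \omega_1\in{\rm Ass}_X^{k_1},\ \omega_2\in{\rm Ass}_X^{k_2},\ k_1,k_2\ge 1,\ k_1+k_2=k\,\}.$$ Let $\langle\cdot,\cdot\rangle$ be the symmetric $\mathsf{k}$-bilinear form on ${\rm Ass}_X$ for which $\langle u,v\rangle=1$ if $u,v$ are equal words and $\langle u,v\rangle=0$ if they are different words. Then for every integer $k\ge 1$ the spaces $L_X^k$ and $S_X^k$ are orthogonal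 subspaces of ${\rm Ass}_X^k$ for $\langle\cdot,\cdot\rangle$, and $${\rm Ass}_X^k=L_X^k\oplus S_X^k .$$ -/

import Mathlib

/-! Lie elements and shuffle products in the free associative algebra `FreeAlgebra 𝕜 X`. -/

namespace FreeAss

noncomputable section

attribute [local instance] LieRing.ofAssociativeRing

variable (𝕜 : Type*) [Field 𝕜] {X : Type*}

/-- The noncommutative monomial `x_{i_1} x_{i_2} ⋯ x_{i_r}` of a word. -/
def word (w : FreeMonoid X) : FreeAlgebra 𝕜 X :=
  FreeMonoid.lift (FreeAlgebra.ι 𝕜) w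

/-- The basis of monomials, by which the bilinear maps below are defined, consists of the words. -/
theorem basisFreeMonoid_apply (w : FreeMonoid X) :
    FreeAlgebra.basisFreeMonoid 𝕜 X w = word 𝕜 w := by
  simp [FreeAlgebra.basisFreeMonoid, FreeAlgebra.equivMonoidAlgebraFreeMonoid, word]

variable (X) in
/-- The homogeneous component of degree `n` of the free associative algebra: the span of the
monomials of length `n`. -/
def ass (n : ℕ) : Submodule 𝕜 (FreeAlgebra 𝕜 X) :=
  Submodule.span 𝕜 {a | ∃ w : FreeMonoid X, w.length = n ∧ word 𝕜 w = a}

variable (X) in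
/-- The Lie algebra of Lie elements: the Lie subalgebra of the free associative algebra, with the
bracket `ab - ba`, generated by the letters. -/
def lieElements : LieSubalgebra 𝕜 (FreeAlgebra 𝕜 X) :=
  LieSubalgebra.lieSpan 𝕜 (FreeAlgebra 𝕜 X) (Set.range (FreeAlgebra.ι 𝕜))

variable (X) in
/-- The space of homogeneous Lie elements of degree `n`. -/
def lieComponent (n : ℕ) : Submodule 𝕜 (FreeAlgebra 𝕜 X) :=
  (lieElements 𝕜 X).toSubmodule ⊓ ass 𝕜 X n

/-- All interleavings of two words that keep the letters of either word in their order, listed with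
multiplicity: one for each choice of the positions of the letters of the first word. Each one starts
either with the first letter of the first word or with the first letter of the second word. -/
def shuffles : List X → List X → List (List X)
  | [], v => [v]
  | a :: u, [] => [a :: u]
  | a :: u, b :: v =>
      (shuffles u (b :: v)).map (List.cons a) ++ (shuffles (a :: u) v).map (List.cons b)
termination_by u v => u.length + v.length

/-- The shuffle product of two words, as the sum of all their shuffles. -/
def shuffleWords (u v : FreeMonoid X) : FreeAlgebra 𝕜 X :=
  ((shuffles u.toList v.toList).map fun w => word 𝕜 (FreeMonoid.ofList w)).sum

variable (X) in
/-- The shuffle product on the free associative algebra: the bilinear extension of the shuffle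
product of words. -/
def shuffle : FreeAlgebra 𝕜 X →ₗ[𝕜] FreeAlgebra 𝕜 X →ₗ[𝕜] FreeAlgebra 𝕜 X :=
  (FreeAlgebra.basisFreeMonoid 𝕜 X).constr 𝕜 fun u =>
    (FreeAlgebra.basisFreeMonoid 𝕜 X).constr 𝕜 fun v => shuffleWords 𝕜 u v

theorem shuffle_word (u v : FreeMonoid X) :
    shuffle 𝕜 X (word 𝕜 u) (word 𝕜 v) = shuffleWords 𝕜 u v := by
  simp only [shuffle, ← basisFreeMonoid_apply, Module.Basis.constr_basis]

variable (X) in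
/-- The span of the shuffle products of total degree `n` of two homogeneous elements of positive
degree. -/
def shuffleComponent (n : ℕ) : Submodule 𝕜 (FreeAlgebra 𝕜 X) :=
  Submodule.span 𝕜 {c | ∃ p q : ℕ, 0 < p ∧ 0 < q ∧ p + q = n ∧
    ∃ a ∈ ass 𝕜 X p, ∃ b ∈ ass 𝕜 X q, shuffle 𝕜 X a b = c}

open Classical in
variable (X) in
/-- The canonical bilinear form on the free associative algebra, for which the words are
orthonormal. -/
def wordForm : LinearMap.BilinForm 𝕜 (FreeAlgebra 𝕜 X) :=
  (FreeAlgebra.basisFreeMonoid 𝕜 X).toDual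

open Classical in
theorem wordForm_word (u v : FreeMonoid X) :
    wordForm 𝕜 X (word 𝕜 u) (word 𝕜 v) = if u = v then 1 else 0 := by
  simp only [wordForm, ← basisFreeMonoid_apply, Module.Basis.toDual_apply]

end

end FreeAss

/-! Ree's theorem: the Lie elements and the shuffles are complementary orthogonal subspaces of each
homogeneous component of the free associative algebra.

The proof uses the right-normed bracketing of words, which is a convolution for the unshuffle
coproduct. Its adjoint agrees, up to shuffles, with multiplication by the degree. As its matrix has
integer entries, its image meets the orthogonal of the image trivially. -/

namespace FreeAss

noncomputable section

attribute [local instance] LieRing.ofAssociativeRing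

open scoped TensorProduct

variable (𝕜 : Type*) [Field 𝕜] {X : Type*}

/-! A Lie element `a` is primitive, `Δa = a ⊗ 1 + 1 ⊗ a`, and the shuffle product is adjoint to `Δ`,
so Lie elements are orthogonal to proper shuffles (`wordForm_lie_shuffle`).

Right-normed bracketing is the convolution of the degree operator with the antipode
(`bracketing_eq_sum_unshuffles`). Its adjoint in degree `n` is therefore `n` times the identity
modulo shuffles (`cobracketing_sub_mem`), so for `n > 0` whatever is orthogonal to the span `B` of
the bracketings is a shuffle. The form may have isotropic vectors over `𝕜`, but integrality reduces
`B ∩ B^⊥ = 0` to positivity over `ℚ` (`sum_mul_eq_zero_of_gram`). Hence `B`, which consists of Lie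
elements, and the shuffles span everything, and an element that is both Lie and shuffle is
orthogonal to both, so zero. -/

/-- The monomial of a list of letters. -/
def mono (l : List X) : FreeAlgebra 𝕜 X := word 𝕜 (FreeMonoid.ofList l)

theorem mono_nil : mono 𝕜 ([] : List X) = 1 := by
  simp [mono, word]

theorem mono_cons (x : X) (l : List X) : mono 𝕜 (x :: l) = FreeAlgebra.ι 𝕜 x * mono 𝕜 l := by
  simp [mono, word]

theorem mono_append (l m : List X) : mono 𝕜 (l ++ m) = mono 𝕜 l * mono 𝕜 m := by
  simp [mono, word]

theorem mono_mem_ass (l : List X) : mono 𝕜 l ∈ ass 𝕜 X l.length :=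
  Submodule.subset_span ⟨FreeMonoid.ofList l, rfl, rfl⟩

theorem basisFreeMonoid_eq_mono (l : FreeMonoid X) :
    FreeAlgebra.basisFreeMonoid 𝕜 X l = mono 𝕜 l.toList :=
  basisFreeMonoid_apply 𝕜 l

open Classical in
theorem wordForm_mono (u v : List X) :
    wordForm 𝕜 X (mono 𝕜 u) (mono 𝕜 v) = if u = v then 1 else 0 := by
  simp [mono, wordForm_word]

theorem wordForm_isSymm : (wordForm 𝕜 X).IsSymm := by
  classical
  refine ⟨fun a b => ?_⟩
  have : wordForm 𝕜 X = (wordForm 𝕜 X).flip := by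
    refine (FreeAlgebra.basisFreeMonoid 𝕜 X).ext fun u =>
      (FreeAlgebra.basisFreeMonoid 𝕜 X).ext fun v => ?_
    simp only [basisFreeMonoid_apply, LinearMap.BilinForm.flip_apply, wordForm_word, eq_comm]
  simpa using LinearMap.congr_fun₂ this a b

theorem wordForm_comm (a b : FreeAlgebra 𝕜 X) : wordForm 𝕜 X a b = wordForm 𝕜 X b a :=
  (wordForm_isSymm 𝕜).eq a b

theorem eq_zero_of_wordForm_mono {a : FreeAlgebra 𝕜 X}
    (h : ∀ l, wordForm 𝕜 X (mono 𝕜 l) a = 0) : a = 0 := by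
  classical
  refine (FreeAlgebra.basisFreeMonoid 𝕜 X).ext_elem fun l => ?_
  rw [map_zero, Finsupp.zero_apply, ← Module.Basis.toDual_apply_right, basisFreeMonoid_eq_mono]
  exact h l.toList

theorem mem_ass_of_span {n : ℕ} {p : Submodule 𝕜 (FreeAlgebra 𝕜 X)}
    (h : ∀ l : List X, l.length = n → mono 𝕜 l ∈ p) : ass 𝕜 X n ≤ p := by
  refine Submodule.span_le.2 ?_
  rintro _ ⟨w, hw, rfl⟩
  exact h w.toList hw

theorem wordForm_mono_of_mem_ass {n : ℕ} {a : FreeAlgebra 𝕜 X} (ha : a ∈ ass 𝕜 X n) {l : List X}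
    (hl : l.length ≠ n) : wordForm 𝕜 X (mono 𝕜 l) a = 0 := by
  classical
  have : ass 𝕜 X n ≤ LinearMap.ker (wordForm 𝕜 X (mono 𝕜 l)) :=
    mem_ass_of_span 𝕜 fun m hm => by
      rw [LinearMap.mem_ker, wordForm_mono, if_neg]
      rintro rfl
      exact hl hm
  exact this ha

theorem ι_mul_mem_ass (x : X) {n : ℕ} {a : FreeAlgebra 𝕜 X} (ha : a ∈ ass 𝕜 X n) :
    FreeAlgebra.ι 𝕜 x * a ∈ ass 𝕜 X (n + 1) := by
  have : ass 𝕜 X n ≤ (ass 𝕜 X (n + 1)).comap (LinearMap.mulLeft 𝕜 (FreeAlgebra.ι 𝕜 x)) :=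
    mem_ass_of_span 𝕜 fun l hl => by
      simpa [← mono_cons, ← hl] using mono_mem_ass 𝕜 (x :: l)
  exact this ha

theorem mul_ι_mem_ass (x : X) {n : ℕ} {a : FreeAlgebra 𝕜 X} (ha : a ∈ ass 𝕜 X n) :
    a * FreeAlgebra.ι 𝕜 x ∈ ass 𝕜 X (n + 1) := by
  have : ass 𝕜 X n ≤ (ass 𝕜 X (n + 1)).comap (LinearMap.mulRight 𝕜 (FreeAlgebra.ι 𝕜 x)) :=
    mem_ass_of_span 𝕜 fun l hl => by
      simpa [mono_append, mono_cons, mono_nil, ← hl] using mono_mem_ass 𝕜 (l ++ [x])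
  exact this ha

/-! ### Unshuffles -/

/-- All ways of distributing the letters of a word over two words, in order. -/
def unshuffles : List X → List (List X × List X)
  | [] => [([], [])]
  | x :: a => (unshuffles a).map (Prod.map (List.cons x) id) ++
      (unshuffles a).map (Prod.map id (List.cons x))

open Classical in
-- Both sides count the ways to read `a` as a shuffle of `u` and `v`; the induction decides which of
-- the two supplies the first letter.
theorem sum_shuffles_eq_sum_unshuffles (a u v : List X) :
    ((shuffles u v).map fun w => if a = w then (1 : 𝕜) else 0).sum =
      ((unshuffles a).map fun p => if p.1 = u ∧ p.2 = v then (1 : 𝕜) else 0).sum := by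
  induction a generalizing u v with
  | nil =>
    cases u <;> cases v <;>
      simp [shuffles, unshuffles, List.map_map, Function.comp_def]
  | cons x a ih =>
    rcases u with _ | ⟨b, u⟩ <;> rcases v with _ | ⟨c, v⟩
    · simp [shuffles, unshuffles, List.map_map, Function.comp_def]
    · have := ih [] v
      by_cases hc : x = c <;>
        simp_all [shuffles, unshuffles, List.map_map, Function.comp_def]
    · have := ih u []
      have h : shuffles u [] = [u] := by cases u <;> simp [shuffles]
      by_cases hb : x = b <;>
        simp_all [shuffles, unshuffles, List.map_map, Function.comp_def]
    · have h₁ := ih u (c :: v)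
      have h₂ := ih (b :: u) v
      by_cases hb : x = b <;> by_cases hc : x = c <;>
        simp_all [shuffles, unshuffles, List.map_map, Function.comp_def]

/-- The shuffle product of two lists of letters. -/
theorem shuffle_mono (u v : List X) :
    shuffle 𝕜 X (mono 𝕜 u) (mono 𝕜 v) = ((shuffles u v).map (mono 𝕜)).sum :=
  shuffle_word 𝕜 _ _

open Classical in
theorem wordForm_shuffle (a u v : List X) :
    wordForm 𝕜 X (mono 𝕜 a) (shuffle 𝕜 X (mono 𝕜 u) (mono 𝕜 v)) =
      ((unshuffles a).map fun p => if p.1 = u ∧ p.2 = v then (1 : 𝕜) else 0).sum := by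
  rw [← sum_shuffles_eq_sum_unshuffles, shuffle_mono, map_list_sum, List.map_map]
  simp only [Function.comp_def, wordForm_mono]

theorem length_of_mem_shuffles {u v w : List X} (h : w ∈ shuffles u v) :
    w.length = u.length + v.length := by
  induction u, v using shuffles.induct generalizing w with
  | case1 v => simp_all [shuffles]
  | case2 a u => simp_all [shuffles]
  | case3 a u b v ih₁ ih₂ =>
    simp only [shuffles, List.mem_append, List.mem_map] at h
    rcases h with ⟨w, hw, rfl⟩ | ⟨w, hw, rfl⟩
    · have := ih₁ hw
      simp at this ⊢
      omega
    · have := ih₂ hw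
      simp at this ⊢
      omega

theorem shuffle_mem_ass {p q : ℕ} {a b : FreeAlgebra 𝕜 X} (ha : a ∈ ass 𝕜 X p)
    (hb : b ∈ ass 𝕜 X q) : shuffle 𝕜 X a b ∈ ass 𝕜 X (p + q) := by
  have h₁ : ∀ u : List X, u.length = p →
      ass 𝕜 X q ≤ (ass 𝕜 X (p + q)).comap (shuffle 𝕜 X (mono 𝕜 u)) := fun u hu =>
    mem_ass_of_span 𝕜 fun v hv => by
      rw [Submodule.mem_comap, shuffle_mono]
      refine list_sum_mem fun c hc => ?_
      obtain ⟨w, hw, rfl⟩ := List.mem_map.1 hc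
      rw [← hu, ← hv, ← length_of_mem_shuffles hw]
      exact mono_mem_ass 𝕜 w
  have h₂ : ass 𝕜 X p ≤ (ass 𝕜 X (p + q)).comap ((shuffle 𝕜 X).flip b) :=
    mem_ass_of_span 𝕜 fun u hu => h₁ u hu hb
  exact h₂ ha

theorem shuffleComponent_le_ass (n : ℕ) : shuffleComponent 𝕜 X n ≤ ass 𝕜 X n := by
  refine Submodule.span_le.2 ?_
  rintro _ ⟨p, q, -, -, rfl, a, ha, b, hb, rfl⟩
  exact shuffle_mem_ass 𝕜 ha hb

/-! ### Lie elements are orthogonal to shuffles -/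

variable (X) in
/-- The coproduct of the free associative algebra for which the letters are primitive. -/
def coproduct : FreeAlgebra 𝕜 X →ₐ[𝕜] FreeAlgebra 𝕜 X ⊗[𝕜] FreeAlgebra 𝕜 X :=
  FreeAlgebra.lift 𝕜 fun x => FreeAlgebra.ι 𝕜 x ⊗ₜ 1 + 1 ⊗ₜ FreeAlgebra.ι 𝕜 x

theorem coproduct_mono (a : List X) :
    coproduct 𝕜 X (mono 𝕜 a) =
      ((unshuffles a).map fun p => mono 𝕜 p.1 ⊗ₜ[𝕜] mono 𝕜 p.2).sum := by
  induction a with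
  | nil => simp [unshuffles, mono_nil, Algebra.TensorProduct.one_def]
  | cons x a ih =>
    rw [mono_cons, map_mul, ih]
    simp [coproduct, unshuffles, add_mul, ← List.sum_map_mul_left, Function.comp_def, mono_cons]

/-- Primitive elements are closed under commutators: the cross terms `a ⊗ b` and `b ⊗ a` cancel. -/
theorem coproduct_of_mem_lieElements {a : FreeAlgebra 𝕜 X} (ha : a ∈ lieElements 𝕜 X) :
    coproduct 𝕜 X a = a ⊗ₜ 1 + 1 ⊗ₜ a := by
  induction ha using LieSubalgebra.lieSpan_induction with
  | mem a h =>
    obtain ⟨x, rfl⟩ := h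
    simp [coproduct]
  | zero => simp
  | add a b _ _ ha hb =>
    simp only [map_add, ha, hb, TensorProduct.add_tmul, TensorProduct.tmul_add]
    abel
  | smul c a _ ha => simp [ha, TensorProduct.smul_tmul']
  | lie a b _ _ ha hb =>
    simp only [LieRing.of_associative_ring_bracket, map_sub, map_mul, ha, hb, add_mul, mul_add,
      Algebra.TensorProduct.tmul_mul_tmul, one_mul, mul_one, TensorProduct.sub_tmul,
      TensorProduct.tmul_sub]
    abel

/-- Pairing of the coproduct with a tensor product of words. -/
def pairing (u v : List X) : FreeAlgebra 𝕜 X ⊗[𝕜] FreeAlgebra 𝕜 X →ₗ[𝕜] 𝕜 :=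
  LinearMap.mul' 𝕜 𝕜 ∘ₗ
    TensorProduct.map ((wordForm 𝕜 X).flip (mono 𝕜 u)) ((wordForm 𝕜 X).flip (mono 𝕜 v))

theorem pairing_tmul (u v : List X) (a b : FreeAlgebra 𝕜 X) :
    pairing 𝕜 u v (a ⊗ₜ b) = wordForm 𝕜 X a (mono 𝕜 u) * wordForm 𝕜 X b (mono 𝕜 v) := by
  simp [pairing]

theorem pairing_coproduct (u v : List X) (a : FreeAlgebra 𝕜 X) :
    pairing 𝕜 u v (coproduct 𝕜 X a) =
      wordForm 𝕜 X a (shuffle 𝕜 X (mono 𝕜 u) (mono 𝕜 v)) := by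
  classical
  have : pairing 𝕜 u v ∘ₗ (coproduct 𝕜 X).toLinearMap =
      (wordForm 𝕜 X).flip (shuffle 𝕜 X (mono 𝕜 u) (mono 𝕜 v)) := by
    refine (FreeAlgebra.basisFreeMonoid 𝕜 X).ext fun w => ?_
    simp only [basisFreeMonoid_eq_mono, LinearMap.comp_apply, AlgHom.toLinearMap_apply,
      LinearMap.BilinForm.flip_apply, coproduct_mono, wordForm_shuffle, map_list_sum, List.map_map]
    refine congrArg List.sum (List.map_congr_left fun p _ => ?_)
    simp only [Function.comp_apply, pairing_tmul, wordForm_mono]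
    split_ifs <;> simp_all
  exact LinearMap.congr_fun this a

theorem wordForm_lie_shuffle {a : FreeAlgebra 𝕜 X} (ha : a ∈ lieElements 𝕜 X) {u v : List X}
    (hu : u ≠ []) (hv : v ≠ []) :
    wordForm 𝕜 X a (shuffle 𝕜 X (mono 𝕜 u) (mono 𝕜 v)) = 0 := by
  classical
  rw [← pairing_coproduct, coproduct_of_mem_lieElements 𝕜 ha, map_add, pairing_tmul, pairing_tmul,
    ← mono_nil, wordForm_mono, wordForm_mono, if_neg hu.symm, if_neg hv.symm]
  simp

theorem wordForm_lie_shuffleComponent {a : FreeAlgebra 𝕜 X} (ha : a ∈ lieElements 𝕜 X) {n : ℕ}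
    {b : FreeAlgebra 𝕜 X} (hb : b ∈ shuffleComponent 𝕜 X n) : wordForm 𝕜 X a b = 0 := by
  have : shuffleComponent 𝕜 X n ≤ LinearMap.ker (wordForm 𝕜 X a) := by
    refine Submodule.span_le.2 ?_
    rintro _ ⟨p, q, hp, hq, -, c, hc, d, hd, rfl⟩
    have h₁ : ∀ u : List X, u.length = p → ass 𝕜 X q ≤
        LinearMap.ker (wordForm 𝕜 X a ∘ₗ shuffle 𝕜 X (mono 𝕜 u)) := fun u hu =>
      mem_ass_of_span 𝕜 fun v hv => wordForm_lie_shuffle 𝕜 ha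
        (List.ne_nil_of_length_pos (hu ▸ hp)) (List.ne_nil_of_length_pos (hv ▸ hq))
    have h₂ : ass 𝕜 X p ≤ LinearMap.ker (wordForm 𝕜 X a ∘ₗ (shuffle 𝕜 X).flip d) :=
      mem_ass_of_span 𝕜 fun u hu => h₁ u hu hd
    exact h₂ hc
  exact this hb

/-! ### Right-normed brackets -/

/-- The right-normed bracketing `[x_1, [x_2, …, [x_{r-1}, x_r]]]` of a word. -/
def bracketing : List X → FreeAlgebra 𝕜 X
  | [] => 0
  | [x] => FreeAlgebra.ι 𝕜 x
  | x :: y :: a => ⁅FreeAlgebra.ι 𝕜 x, bracketing (y :: a)⁆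

open Classical in
-- The last term compensates for the value `0` on the empty word, making the recursion uniform.
theorem bracketing_cons (x : X) (a : List X) :
    bracketing 𝕜 (x :: a) = FreeAlgebra.ι 𝕜 x * bracketing 𝕜 a -
      bracketing 𝕜 a * FreeAlgebra.ι 𝕜 x + if a = [] then FreeAlgebra.ι 𝕜 x else 0 := by
  cases a <;> simp [bracketing, LieRing.of_associative_ring_bracket]

theorem bracketing_mem_lieElements (a : List X) : bracketing 𝕜 a ∈ lieElements 𝕜 X := by
  induction a using bracketing.induct with
  | case1 => exact zero_mem _
  | case2 x => exact LieSubalgebra.subset_lieSpan ⟨x, rfl⟩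
  | case3 x y a ih => exact LieSubalgebra.lie_mem _ (LieSubalgebra.subset_lieSpan ⟨x, rfl⟩) ih

theorem bracketing_mem_ass (a : List X) : bracketing 𝕜 a ∈ ass 𝕜 X a.length := by
  classical
  induction a with
  | nil => exact zero_mem _
  | cons x a ih =>
    rw [bracketing_cons]
    refine add_mem (sub_mem (ι_mul_mem_ass 𝕜 x ih) (mul_ι_mem_ass 𝕜 x ih)) ?_
    split_ifs with h
    · subst h
      simpa [mono_cons, mono_nil] using mono_mem_ass 𝕜 [x]
    · exact zero_mem _

theorem list_sum_map_neg {ι A : Type*} [AddCommGroup A] (l : List ι) (f : ι → A) :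
    (l.map fun i => -f i).sum = -(l.map f).sum := by
  induction l with
  | nil => simp
  | cons i l ih => simp [ih, add_comm]

theorem list_sum_map_finset_sum {ι κ A : Type*} [AddCommMonoid A] (l : List ι) (s : Finset κ)
    (f : ι → κ → A) : (l.map fun i => ∑ j ∈ s, f i j).sum = ∑ j ∈ s, (l.map fun i => f i j).sum := by
  induction l with
  | nil => simp
  | cons i l ih => simp [ih, Finset.sum_add_distrib]

open Classical in
-- The antipode identity `id ⋆ S = ε`, with `S` reversing words up to sign. The first letter `x`
-- contributes `x * ε(a) - ε(a) * x = 0`.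
theorem sum_unshuffles_antipode (a : List X) :
    ((unshuffles a).map fun p => (-1 : 𝕜) ^ p.2.length • (mono 𝕜 (p.1 ++ p.2.reverse))).sum =
      if a = [] then 1 else 0 := by
  induction a with
  | nil => simp [unshuffles, mono_nil]
  | cons x a ih =>
    have h₁ := congrArg (FreeAlgebra.ι 𝕜 x * ·) ih
    have h₂ := congrArg (· * FreeAlgebra.ι 𝕜 x) ih
    simp only [← List.sum_map_mul_left, ← List.sum_map_mul_right, mul_smul_comm,
      smul_mul_assoc] at h₁ h₂
    simp only [unshuffles, List.map_append, List.sum_append, List.map_map, Function.comp_def,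
      Prod.map_fst, Prod.map_snd, id, List.length_cons, List.cons_append, List.reverse_cons,
      ← List.append_assoc, mono_append _ _ [x], mono_cons, mono_nil, mul_one, pow_succ, mul_neg,
      neg_smul, list_sum_map_neg]
    rw [h₁, h₂, if_neg (List.cons_ne_nil x a)]
    split_ifs <;> simp

/-- Sending `x` to the left factor raises its length by one; the surplus is `x` times the antipode
sum, which is the correction term of `bracketing_cons`. -/
theorem bracketing_eq_sum_unshuffles (a : List X) :
    bracketing 𝕜 a = ((unshuffles a).map fun p =>
      ((p.1.length : 𝕜) * (-1) ^ p.2.length) • (mono 𝕜 (p.1 ++ p.2.reverse))).sum := by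
  classical
  induction a with
  | nil => simp [unshuffles, bracketing]
  | cons x a ih =>
    have h₀ := congrArg (FreeAlgebra.ι 𝕜 x * ·) (sum_unshuffles_antipode 𝕜 a)
    have h₁ := congrArg (FreeAlgebra.ι 𝕜 x * ·) ih
    have h₂ := congrArg (· * FreeAlgebra.ι 𝕜 x) ih
    simp only [← List.sum_map_mul_left, ← List.sum_map_mul_right, mul_smul_comm,
      smul_mul_assoc] at h₀ h₁ h₂
    simp only [unshuffles, List.map_append, List.sum_append, List.map_map, Function.comp_def,
      Prod.map_fst, Prod.map_snd, id, List.length_cons, List.cons_append, List.reverse_cons,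
      ← List.append_assoc, mono_append _ _ [x], mono_cons, mono_nil, mul_one, pow_succ, mul_neg,
      neg_smul, list_sum_map_neg, Nat.cast_succ, add_mul,
      one_mul, add_smul, List.sum_map_add]
    rw [h₀, ← h₁, ← h₂, bracketing_cons]
    split_ifs <;> simp <;> abel

/-! ### The adjoint of the bracketing -/

/-- The adjoint of the bracketing, applied to a word. -/
def cobracketing (w : List X) : FreeAlgebra 𝕜 X :=
  ∑ i ∈ Finset.range (w.length + 1), ((i : 𝕜) * (-1) ^ (w.length - i)) •
    shuffle 𝕜 X (mono 𝕜 (w.take i)) (mono 𝕜 (w.drop i).reverse)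

theorem wordForm_bracketing_mono (a w : List X) :
    wordForm 𝕜 X (bracketing 𝕜 a) (mono 𝕜 w) = wordForm 𝕜 X (mono 𝕜 a) (cobracketing 𝕜 w) := by
  classical
  rw [bracketing_eq_sum_unshuffles, ← LinearMap.BilinForm.flip_apply]
  simp only [cobracketing, map_sum, map_smul, wordForm_shuffle, smul_eq_mul, map_list_sum,
    List.map_map, ← List.sum_map_mul_left]
  rw [← list_sum_map_finset_sum]
  refine congrArg List.sum (List.map_congr_left fun p _ => ?_)
  simp only [Function.comp_apply, map_smul, LinearMap.BilinForm.flip_apply, wordForm_mono,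
    smul_eq_mul]
  by_cases h : p.1 ++ p.2.reverse = w
  · subst h
    -- Only the cut at `p.1.length` splits the word into `p.1` and the reverse of `p.2`.
    rw [Finset.sum_eq_single p.1.length]
    · simp
    · intro i hi hne
      rw [if_neg, mul_zero]
      rintro ⟨h, -⟩
      have := congrArg List.length h
      simp only [List.length_take, List.length_append, List.length_reverse] at this
      simp only [Finset.mem_range, List.length_append, List.length_reverse] at hi
      omega
    · intro hi
      simp at hi
  · rw [if_neg h, mul_zero, Finset.sum_eq_zero]
    intro i _
    rw [if_neg, mul_zero]
    rintro ⟨h₁, h₂⟩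
    simp [h₁, h₂] at h

theorem cobracketing_sub_mem (w : List X) :
    cobracketing 𝕜 w - (w.length : 𝕜) • mono 𝕜 w ∈ shuffleComponent 𝕜 X w.length := by
  have h : shuffle 𝕜 X (mono 𝕜 w) (mono 𝕜 []) = mono 𝕜 w := by
    rw [shuffle_mono]
    cases w <;> simp [shuffles]
  rw [cobracketing, Finset.sum_range_succ]
  simp only [List.take_length, List.drop_length, List.reverse_nil, tsub_self, pow_zero, mul_one, h,
    add_sub_cancel_right]
  refine sum_mem fun i hi => ?_
  rw [Finset.mem_range] at hi
  rcases Nat.eq_zero_or_pos i with rfl | hpos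
  -- The empty prefix would not give a proper shuffle, but its coefficient `i` vanishes.
  · simp
  · refine Submodule.smul_mem _ _ (Submodule.subset_span
      ⟨i, w.length - i, hpos, by omega, by omega, _, ?_, _, ?_, rfl⟩)
    · simpa [hi.le] using mono_mem_ass 𝕜 (w.take i)
    · simpa using mono_mem_ass 𝕜 (w.drop i).reverse

theorem exists_wordForm_bracketing_mono_eq_intCast (a w : List X) :
    ∃ z : ℤ, wordForm 𝕜 X (bracketing 𝕜 a) (mono 𝕜 w) = z := by
  classical
  suffices h : wordForm 𝕜 X (bracketing 𝕜 a) (mono 𝕜 w) ∈ (Int.castRingHom 𝕜).range by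
    obtain ⟨z, hz⟩ := h
    exact ⟨z, hz.symm⟩
  rw [bracketing_eq_sum_unshuffles, ← LinearMap.BilinForm.flip_apply, map_list_sum]
  refine list_sum_mem fun c hc => ?_
  simp only [List.map_map, List.mem_map, Function.comp_apply, map_smul,
    LinearMap.BilinForm.flip_apply, wordForm_mono, smul_eq_mul] at hc
  obtain ⟨p, -, rfl⟩ := hc
  refine mul_mem (mul_mem (natCast_mem _ _) (pow_mem (neg_mem (one_mem _)) _)) ?_
  split_ifs
  exacts [one_mem _, zero_mem _]

variable (X) in
/-- The span of the bracketings of the words of a given length. -/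
def bracketings (n : ℕ) : Submodule 𝕜 (FreeAlgebra 𝕜 X) :=
  Submodule.span 𝕜 (Set.range fun w : List.Vector X n => bracketing 𝕜 w.toList)

theorem bracketings_le_lieComponent (n : ℕ) : bracketings 𝕜 X n ≤ lieComponent 𝕜 X n := by
  refine Submodule.span_le.2 ?_
  rintro _ ⟨w, rfl⟩
  refine ⟨bracketing_mem_lieElements 𝕜 _, ?_⟩
  simpa using bracketing_mem_ass 𝕜 w.toList

/-! ### Orthogonal decomposition when there are finitely many words -/

section Fintype

variable {n : ℕ} [Fintype (List.Vector X n)]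

theorem sum_wordForm_smul_mono {a : FreeAlgebra 𝕜 X} (ha : a ∈ ass 𝕜 X n) :
    ∑ w : List.Vector X n, wordForm 𝕜 X (mono 𝕜 w.toList) a • mono 𝕜 w.toList = a := by
  classical
  have : ass 𝕜 X n ≤ LinearMap.eqLocus (∑ w : List.Vector X n,
      (wordForm 𝕜 X (mono 𝕜 w.toList)).smulRight (mono 𝕜 w.toList)) LinearMap.id := by
    refine mem_ass_of_span 𝕜 fun l hl => ?_
    simp only [LinearMap.mem_eqLocus, LinearMap.sum_apply, LinearMap.smulRight_apply,
      wordForm_mono, LinearMap.id_apply]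
    rw [Finset.sum_eq_single ⟨l, hl⟩]
    · simp
    · intro w _ hw
      rw [if_neg, zero_smul]
      rintro rfl
      exact hw rfl
    · exact fun h => absurd (Finset.mem_univ _) h
  simpa using this ha

variable [CharZero 𝕜]

/-- Ree's criterion: the orthogonal of the bracketings consists of shuffles. -/
theorem mem_shuffleComponent_of_orthogonal (hn : n ≠ 0) {a : FreeAlgebra 𝕜 X}
    (ha : a ∈ ass 𝕜 X n) (h : ∀ b ∈ bracketings 𝕜 X n, wordForm 𝕜 X b a = 0) :
    a ∈ shuffleComponent 𝕜 X n := by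
  set c : List.Vector X n → 𝕜 := fun w => wordForm 𝕜 X (mono 𝕜 w.toList) a with hc
  have hsum : ∑ w, c w • mono 𝕜 w.toList = a := sum_wordForm_smul_mono 𝕜 ha
  set e : FreeAlgebra 𝕜 X := ∑ w, c w • cobracketing 𝕜 w.toList with he
  have hsub : e - (n : 𝕜) • a ∈ shuffleComponent 𝕜 X n := by
    rw [← hsum, Finset.smul_sum, he, ← Finset.sum_sub_distrib]
    refine sum_mem fun w _ => ?_
    rw [smul_comm, ← smul_sub]
    exact Submodule.smul_mem _ _ (by simpa using cobracketing_sub_mem 𝕜 w.toList)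
  have he_mem : e ∈ ass 𝕜 X n :=
    ((ass 𝕜 X n).sub_mem_iff_left (Submodule.smul_mem _ _ ha)).1
      (shuffleComponent_le_ass 𝕜 n hsub)
  -- By adjointness, the coefficient of `e` at a word is the pairing of its bracketing with `a`.
  have he_zero : e = 0 := by
    refine eq_zero_of_wordForm_mono 𝕜 fun l => ?_
    by_cases hl : l.length = n
    · have : wordForm 𝕜 X (bracketing 𝕜 l) a = 0 :=
        h _ (Submodule.subset_span ⟨⟨l, hl⟩, rfl⟩)
      rw [← hsum] at this
      simpa only [he, map_sum, map_smul, wordForm_bracketing_mono] using this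
    · exact wordForm_mono_of_mem_ass 𝕜 he_mem hl
  rw [he_zero, zero_sub, neg_mem_iff] at hsub
  exact (Submodule.smul_mem_iff _ (Nat.cast_ne_zero.2 hn)).1 hsub

/-- A matrix with integer entries and its product with its transpose have the same kernel over any
field of characteristic zero. -/
theorem sum_mul_eq_zero_of_gram {ι κ : Type*} [Fintype ι] [Fintype κ] (M : ι → κ → ℤ) (c : ι → 𝕜)
    (h : ∀ i, ∑ w, M i w • ∑ j, M j w • c j = 0) (w : κ) : ∑ j, M j w • c j = 0 := by
  -- `𝕜` need not be ordered. The `ℚ`-linear functionals separate its points and commute with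
  -- integer matrices, and in `ℚ` a vanishing sum of squares has vanishing terms.
  refine (Module.forall_dual_apply_eq_zero_iff ℚ _).1 fun φ => ?_
  have hφ : ∀ i, ∑ w, M i w • φ (∑ j, M j w • c j) = 0 := fun i => by
    simpa only [map_sum, map_zsmul, map_zero] using congrArg φ (h i)
  have hsq : ∑ w, φ (∑ j, M j w • c j) * φ (∑ j, M j w • c j) = 0 := by
    calc ∑ w, φ (∑ j, M j w • c j) * φ (∑ j, M j w • c j)
        = ∑ w, ∑ i, φ (c i) * (M i w • φ (∑ j, M j w • c j)) := by
          refine Finset.sum_congr rfl fun w _ => ?_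
          conv_lhs => enter [1]; rw [map_sum]
          rw [Finset.sum_mul]
          refine Finset.sum_congr rfl fun i _ => ?_
          rw [map_zsmul, zsmul_eq_mul, zsmul_eq_mul]
          ring
      _ = 0 := by
          rw [Finset.sum_comm]
          simp only [← Finset.mul_sum, hφ, mul_zero, Finset.sum_const_zero]
  exact mul_self_eq_zero.1
    ((Finset.sum_eq_zero_iff_of_nonneg fun w _ => mul_self_nonneg _).1 hsq w (Finset.mem_univ w))

theorem disjoint_bracketings_orthogonal :
    Disjoint (bracketings 𝕜 X n) ((wordForm 𝕜 X).orthogonal (bracketings 𝕜 X n)) := by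
  rw [Submodule.disjoint_def]
  intro b hb horth
  have hb_mem : b ∈ ass 𝕜 X n := (bracketings_le_lieComponent 𝕜 n hb).2
  obtain ⟨c, hc⟩ := (Submodule.mem_span_range_iff_exists_fun 𝕜).1 hb
  choose M hM using exists_wordForm_bracketing_mono_eq_intCast 𝕜 (X := X)
  have hcoeff : ∀ w : List X, wordForm 𝕜 X (mono 𝕜 w) b =
      ∑ j : List.Vector X n, M j.toList w • c j := fun w => by
    rw [← hc, map_sum]
    refine Finset.sum_congr rfl fun j _ => ?_
    rw [map_smul, wordForm_comm, hM, smul_eq_mul, zsmul_eq_mul, mul_comm]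
  have hgram := sum_mul_eq_zero_of_gram 𝕜 (fun i w : List.Vector X n => M i.toList w.toList) c
    fun i => by
      have : wordForm 𝕜 X (bracketing 𝕜 i.toList) b = 0 :=
        horth _ (Submodule.subset_span ⟨i, rfl⟩)
      rw [← sum_wordForm_smul_mono 𝕜 hb_mem, map_sum] at this
      rw [← this]
      refine Finset.sum_congr rfl fun w _ => ?_
      rw [map_smul, hM, hcoeff, zsmul_eq_mul, smul_eq_mul, mul_comm]
  refine eq_zero_of_wordForm_mono 𝕜 fun l => ?_
  by_cases hl : l.length = n
  · rw [hcoeff]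
    exact hgram ⟨l, hl⟩
  · exact wordForm_mono_of_mem_ass 𝕜 hb_mem hl

/-- The form is nondegenerate on the finite-dimensional span of the bracketings, so `a` has an
orthogonal projection `b` there, and `a - b` is a shuffle by Ree's criterion. -/
theorem bracketings_sup_shuffleComponent (hn : n ≠ 0) :
    bracketings 𝕜 X n ⊔ shuffleComponent 𝕜 X n = ass 𝕜 X n := by
  have hle : bracketings 𝕜 X n ≤ ass 𝕜 X n :=
    (bracketings_le_lieComponent 𝕜 n).trans inf_le_right
  refine le_antisymm (sup_le hle (shuffleComponent_le_ass 𝕜 n)) fun a ha => ?_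
  have : FiniteDimensional 𝕜 (bracketings 𝕜 X n) :=
    FiniteDimensional.span_of_finite 𝕜 (Set.finite_range _)
  have hrefl := (wordForm_isSymm (X := X) 𝕜).isRefl
  have hnondeg := LinearMap.BilinForm.nondegenerate_restrict_of_disjoint_orthogonal _ hrefl
    (disjoint_bracketings_orthogonal (X := X) (n := n) 𝕜)
  obtain ⟨b, hb⟩ : ∃ b : bracketings 𝕜 X n, ∀ d : bracketings 𝕜 X n,
      wordForm 𝕜 X b d = wordForm 𝕜 X a d :=
    ⟨(LinearMap.BilinForm.toDual _ hnondeg).symm ((wordForm 𝕜 X a).domRestrict _),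
      LinearMap.BilinForm.apply_toDual_symm_apply (hB := hnondeg) _⟩
  rw [← add_sub_cancel (b : FreeAlgebra 𝕜 X) a]
  refine Submodule.add_mem_sup b.2
    (mem_shuffleComponent_of_orthogonal 𝕜 hn (sub_mem ha (hle b.2)) fun d hd => ?_)
  rw [map_sub, wordForm_comm 𝕜 d a, wordForm_comm 𝕜 d b, hb ⟨d, hd⟩, sub_self]

theorem disjoint_lieComponent_shuffleComponent (hn : n ≠ 0) :
    Disjoint (lieComponent 𝕜 X n) (shuffleComponent 𝕜 X n) := by
  rw [Submodule.disjoint_def]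
  intro a ha hs
  refine eq_zero_of_wordForm_mono 𝕜 fun l => ?_
  by_cases hl : l.length = n
  · have hmem := hl ▸ mono_mem_ass 𝕜 l
    rw [← bracketings_sup_shuffleComponent 𝕜 hn] at hmem
    obtain ⟨b, hb, c, hc, hbc⟩ := Submodule.mem_sup.1 hmem
    rw [← hbc, map_add, LinearMap.add_apply,
      wordForm_lie_shuffleComponent 𝕜 (bracketings_le_lieComponent 𝕜 n hb).1 hs,
      wordForm_comm, wordForm_lie_shuffleComponent 𝕜 ha.1 hc, add_zero]
  · exact wordForm_mono_of_mem_ass 𝕜 ha.2 hl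

end Fintype

end

end FreeAss

theorem theorem2 (𝕜 : Type*) [Field 𝕜] [CharZero 𝕜] (X : Type*) [Finite X] (k : ℕ) (hk : 1 ≤ k) :
    (∀ a ∈ FreeAss.lieComponent 𝕜 X k, ∀ b ∈ FreeAss.shuffleComponent 𝕜 X k,
      FreeAss.wordForm 𝕜 X a b = 0) ∧
    Disjoint (FreeAss.lieComponent 𝕜 X k) (FreeAss.shuffleComponent 𝕜 X k) ∧
    FreeAss.lieComponent 𝕜 X k ⊔ FreeAss.shuffleComponent 𝕜 X k = FreeAss.ass 𝕜 X k := by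
  classical
  have := Fintype.ofFinite X
  have hk : k ≠ 0 := Nat.one_le_iff_ne_zero.1 hk
  refine ⟨fun a ha b hb => FreeAss.wordForm_lie_shuffleComponent 𝕜 ha.1 hb,
    FreeAss.disjoint_lieComponent_shuffleComponent 𝕜 hk,
    le_antisymm (sup_le inf_le_right (FreeAss.shuffleComponent_le_ass 𝕜 k)) ?_⟩
  rw [← FreeAss.bracketings_sup_shuffleComponent 𝕜 hk]
  exact sup_le_sup_right (FreeAss.bracketings_le_lieComponent 𝕜 k) _
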